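/- Let $\mathcal G$ be a weighted directed graph on $m$ agents with weights $a_{ij}\ge 0$, $a_{ii}=0$, where $a_{ij}>0$ iff there is a link from agent $j$ to agent $i$, and let $L=\mathcal A-D$ with $\mathcal A=(a_{ij})$ and $D=\mathrm{diag}\big(\sum_j a_{1j},\dots,\sum_j a_{mj}\big)$. Suppose that $\mathcal G$ has a spanning tree and exactly two strongly connected components $SCC_1$, $SCC_2$, of sizes $n_1$, $n_2$, and that $$L=\begin{pmatrix}L^{1,1}&L^{1,2}\\0&L^{2,2}\end{pmatrix},\qquad L^{1,2}\ne 0,$$ where the block $L^{k,k}$ belongs to $SCC_k$; write $x^k_p$ for the state of the $p$-th agent of $SCC_k$. For $k=1,2$ let $\tilde L^{k,k}$ be the matrix with the same off-diagonal entries as $L^{k,k}$ and with all row sums zero, let $D^k_p=L^{k,k}_{pp}-\tilde L^{k,k}_{pp}$, and let $\xi^2$ be the vector with $(\xi^2)^{\top}\tilde L^{2,2}=0$ and $\sum_p\xi^2_p=1$. For $t\ge 0$ consider the system $$\dot x_i(t)=\sum_{j=1}^m L_{ij}\,\hat x_j(t),\qquad \hat x_j(t)=x_j\big(t^j_{k_j(t)}\big),\qquad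 k_j(t)=\max\{l:\ t^j_l\le t\},$$ where $x$ is continuous and the equation is understood for the right derivative. Put $$q^k_p(t)=\sum_{j=1}^{n_k}L^{k,k}_{pj}\,[x^k_j(t)-x^k_p(t)]^2,\quad q^{1,K}_p(t)=\sum_{j=1}^{n_2}L^{1,2}_{pj}\,[x^2_j(t)-x^1_p(t)]^2,\quad q^{2,K}_p(t)=0,$$ and, for constants $\gamma^k_p\in(0,1)$ and $d^k_p\in(0,\tfrac12)$, put $u^k_p=4|L^{k,k}_{pp}|-D^k_p/d^k_p$. (If $u^k_p=0$, which happens only for $k=2$, $n_2=1$, the threshold below is read as $0$.) The trigger times of the agent $i$ that is the $p$-th agent of $SCC_k$ are $t^i_1=0$ and $$t^i_{l+1}=\max\Big\{\tau\ge t^i_l:\ |x^k_p(t)-x^k_p(t^i_l)|\le\sqrt{\tfrac{\gamma^k_p}{u^k_p}\,[q^k_p(t)+q^{k,K}_p(t)]}\ \text{ for all } t\in[t^i_l,\tau]\Big\},$$ where $t^i_l$ is the last trigger time of agent $i$ (and $t^i_{l'}=+\infty$ for all $l'>l$) if the inequality holds for all $t\ge t^i_l$. Then there is $\alpha>0$,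 depending only on $\mathcal G$ and the constants $\gamma^k_p$, $d^k_p$, such that for every solution with $\lim_{l\to\infty}t^i_l=+\infty$ for all agents $i$, the system reaches consensus exponentially, with consensus value $c=\sum_{p=1}^{n_2}\xi^2_p x^2_p(0)$: there is a constant $C$ (depending on the solution) with $|x_i(t)-c|\le C e^{-\alpha t}$ for all $t\ge 0$ and all $i$. In particular $\lim_{t\to\infty}x_i(t)=c$ for all $i$. -/

import Mathlib

open Filter Topology Set

noncomputable section

/-- A weighted directed graph. `weight i j > 0` is the weight of the link from `j` to `i`;
`weight i j = 0` means that there is no such link. There are no self-loops. -/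
structure WeightedDigraph (V : Type) where
  weight : Matrix V V ℝ
  weight_nonneg : ∀ i j, 0 ≤ weight i j
  weight_self : ∀ i, weight i i = 0

namespace WeightedDigraph

variable {V : Type}

/-- There is a directed link from `j` to `i`. -/
def Link (G : WeightedDigraph V) (j i : V) : Prop := 0 < G.weight i j

/-- There is a directed path (possibly of length zero) from `j` to `i`. -/
def Reaches (G : WeightedDigraph V) (j i : V) : Prop := Relation.ReflTransGen G.Link j i

/-- `S` is a strongly connected component: a class of mutual reachability. -/
def IsSCC (G : WeightedDigraph V) (S : Set V) : Prop :=
  ∃ v, S = {w | G.Reaches v w ∧ G.Reaches w v}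

/-- `G` has a (directed) spanning tree: a root `r` and, for every other node `v`, a tree link
from its parent to `v`, such that following parents leads from every node to the root. -/
def HasSpanningTree (G : WeightedDigraph V) : Prop :=
  ∃ (r : V) (parent : V → V),
    (∀ v, v ≠ r → G.Link (parent v) v) ∧ ∀ v, ∃ k : ℕ, parent^[k] v = r

/-- The Laplacian, with the sign convention `L = A - D`, `D` the diagonal in-degree matrix. -/
def laplacian [Fintype V] [DecidableEq V] (G : WeightedDigraph V) : Matrix V V ℝ :=
  G.weight - Matrix.diagonal (fun i => ∑ j, G.weight i j)

end WeightedDigraph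

/-- The agents of a network split into `K` groups, the `k`-th one of size `n k`. The pair
`⟨k, p⟩` is the `p`-th agent of the `k`-th group (both indices start from `0`). -/
abbrev Agent {K : ℕ} (n : Fin K → ℕ) : Type := Σ k : Fin K, Fin (n k)

section Blocks

variable {K : ℕ} {n : Fin K → ℕ}

/-- The block `L^{k,l}` of a matrix. -/
def block (L : Matrix (Agent n) (Agent n) ℝ) (k l : Fin K) :
    Matrix (Fin (n k)) (Fin (n l)) ℝ :=
  fun i j => L ⟨k, i⟩ ⟨l, j⟩

/-- The Laplacian of `G` is in Perron-Frobenius form: block upper triangular, the diagonal blocks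
belonging to the strongly connected components, and each block row but the last having a nonzero
block to the right of the diagonal. -/
structure IsPerronFrobeniusForm (G : WeightedDigraph (Agent n)) : Prop where
  scc : ∀ k : Fin K, G.IsSCC {v | v.1 = k}
  upper : ∀ k l : Fin K, l < k → block G.laplacian k l = 0
  link : ∀ k : Fin K, (k : ℕ) + 1 < K → ∃ l : Fin K, k < l ∧ block G.laplacian k l ≠ 0

/-- The auxiliary matrix `L̃^{k,k}`: the off-diagonal entries of `L^{k,k}`, and the diagonal that
makes all row sums vanish. -/
def blockTilde (L : Matrix (Agent n) (Agent n) ℝ) (k : Fin K) :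
    Matrix (Fin (n k)) (Fin (n k)) ℝ :=
  fun i j => if i = j then -∑ p ∈ Finset.univ.erase i, block L k k i p else block L k k i j

/-- The diagonal entries `D^k_p` of `D^k = L^{k,k} - L̃^{k,k}`. -/
def blockD (L : Matrix (Agent n) (Agent n) ℝ) (v : Agent n) : ℝ :=
  (block L v.1 v.1 - blockTilde L v.1) v.2 v.2

/-- `q^k_p` at the joint state `y`, for the agent `v = ⟨k, p⟩`. -/
def qIntra (L : Matrix (Agent n) (Agent n) ℝ) (y : Agent n → ℝ) (v : Agent n) : ℝ :=
  ∑ j, block L v.1 v.1 v.2 j * (y ⟨v.1, j⟩ - y v) ^ 2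

/-- `q^{k,K}_p` at the joint state `y`, for the agent `v = ⟨k, p⟩`. -/
def qInter (L : Matrix (Agent n) (Agent n) ℝ) (y : Agent n → ℝ) (v : Agent n) : ℝ :=
  ∑ l ∈ Finset.univ.filter (fun l => v.1 < l),
    ∑ j, block L v.1 l v.2 j * (y ⟨l, j⟩ - y v) ^ 2

/-- `u^k_p = 4 |L^{k,k}_{pp}| - D^k_p / d^k_p`, for the agent `v = ⟨k, p⟩`. -/
def uCoeff (L : Matrix (Agent n) (Agent n) ℝ) (d : Agent n → ℝ) (v : Agent n) : ℝ :=
  4 * |block L v.1 v.1 v.2 v.2| - blockD L v / d v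

/-- The trigger threshold of agent `v` at the joint state `y`. (`u = 0` happens only for a
component consisting of one agent without in-neighbours; then `q` vanishes too, that agent does not
move, and the threshold is `0`.) -/
def threshold (L : Matrix (Agent n) (Agent n) ℝ) (γ d : Agent n → ℝ) (y : Agent n → ℝ)
    (v : Agent n) : ℝ :=
  Real.sqrt (γ v / uCoeff L d v * (qIntra L y v + qInter L y v))

end Blocks

section Dynamics

variable {V : Type}

/-- The index `k(t)` of the last trigger at or before time `t`, for a sequence of trigger times;
the value `⊤` stands for a trigger that never takes place. -/
def lastIndex (τ : ℕ → EReal) (t : ℝ) : ℕ := sSup {k : ℕ | τ k ≤ (t : EReal)}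

/-- The state `x̂_v(t)` that agent `v` sent to its out-neighbours at its last trigger time. -/
def heldState (x : ℝ → V → ℝ) (τ : V → ℕ → EReal) (t : ℝ) (v : V) : ℝ :=
  x (τ v (lastIndex (τ v) t)).toReal v

/-- `x` solves `ẋ_v(t) = ∑ j, L_{vj} x̂_j(t)` for `t ≥ 0`. The right-hand side is piecewise
constant and right-continuous, so the solution is continuous and the equation holds for the right
derivative at all times (and for the derivative away from the trigger times). -/
structure IsSolution [Fintype V] (L : Matrix V V ℝ) (x : ℝ → V → ℝ) (τ : V → ℕ → EReal) :
    Prop where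
  continuousOn : ∀ v, ContinuousOn (fun t => x t v) (Ici 0)
  hasDeriv : ∀ t, 0 ≤ t → ∀ v,
    HasDerivWithinAt (fun s => x s v) (∑ j, L v j * heldState x τ t j) (Ici t) t

/-- The times `s ≥ T` such that the state of agent `v` stays, throughout `[T, s]`, within the
threshold `θ` of its state at time `T`. -/
def admissibleTimes (x : ℝ → V → ℝ) (θ : (V → ℝ) → V → ℝ) (v : V) (T : ℝ) : Set ℝ :=
  {s | T ≤ s ∧ ∀ t ∈ Icc T s, |x t v - x T v| ≤ θ (x t) v}

/-- The sequences of trigger times obey the trigger rule with threshold `θ`: every agent is first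
triggered at time `0`; after a trigger at time `T`, the next one is at the maximum of the
admissible times. If all times after `T` are admissible, then the trigger at time `T` was the last
one, which is recorded by the value `⊤` from then on. -/
structure ObeysTriggerRule (x : ℝ → V → ℝ) (θ : (V → ℝ) → V → ℝ) (τ : V → ℕ → EReal) :
    Prop where
  start : ∀ v, τ v 0 = 0
  next : ∀ v l, ∀ T : ℝ, τ v l = (T : EReal) →
    (∃ s : ℝ, τ v (l + 1) = (s : EReal) ∧ IsGreatest (admissibleTimes x θ v T) s) ∨
      (τ v (l + 1) = ⊤ ∧ admissibleTimes x θ v T = Ici T)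
  stop_forever : ∀ v l, τ v l = ⊤ → τ v (l + 1) = ⊤

/-- All components of `x` converge to `c` exponentially with rate `α`. -/
def ConvergesExponentially (x : ℝ → V → ℝ) (c α : ℝ) : Prop :=
  ∃ C : ℝ, ∀ t, 0 ≤ t → ∀ v, |x t v - c| ≤ C * Real.exp (-α * t)

end Dynamics

end

/-! The trigger rule keeps the held state `y + e` so close to the current state `y` (measured from
`c`) that a weighted quadratic energy decays at a fixed rate.

For a strongly connected group with positive left null vector `w`, zero row and column sums turn the
derivative of `∑ w y²` into minus a sum of squared disagreements plus cross terms in `e`. Young's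
inequality spends half of the disagreement on `e` (`energy_le`), and the trigger bound absorbs the
rest because `γ < 1`. What remains is a quadratic form, positive on the relevant cone and hence
coercive by compactness (`exists_coercive`).

The second component evolves on its own. The `ξ`-average of its states is conserved, which fixes
`c`, and the form is positive on the hyperplane of zero average (`exists_decay`). The first
component is damped by its links from the second, so its form is positive everywhere, at the price
of an input term controlled by the second component (`exists_decay_of_input`). Weighting the second
component heavily enough pays for that input (`exists_energy`), and Grönwall's inequality gives
exponential decay. -/

/-! ### Irreducible Laplacians: positive left null vectors and the energy estimate. -/

section LaplacianMatrix

variable {ι κ : Type*} [Fintype ι] [Fintype κ]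

/-- A Laplacian-type (Metzler, zero row sums) matrix whose associated digraph is strongly
connected: a nonempty set of nodes closed under out-links is everything. -/
structure IsIrreducibleLaplacian (M : Matrix ι ι ℝ) : Prop where
  offDiag_nonneg : ∀ p j, p ≠ j → 0 ≤ M p j
  row_sum : ∀ p, ∑ j, M p j = 0
  eq_univ : ∀ S : Set ι, S.Nonempty → (∀ p q, p ∈ S → p ≠ q → 0 < M q p → q ∈ S) → S = univ

/-- The weighted sum `∑ j, M p j * (y j - y p) ^ 2` of squared disagreements at the node `p`. -/
def disagreement (M : Matrix ι ι ℝ) (y : ι → ℝ) (p : ι) : ℝ :=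
  ∑ j, M p j * (y j - y p) ^ 2

namespace IsIrreducibleLaplacian

variable {M : Matrix ι ι ℝ}

theorem diag_nonpos (hM : IsIrreducibleLaplacian M) (p : ι) : M p p ≤ 0 := by
  classical
  have h := hM.row_sum p
  rw [← Finset.add_sum_erase _ _ (Finset.mem_univ p)] at h
  have : 0 ≤ ∑ j ∈ Finset.univ.erase p, M p j :=
    Finset.sum_nonneg fun j hj => hM.offDiag_nonneg p j (Finset.ne_of_mem_erase hj).symm
  linarith

theorem mul_sq_nonneg (hM : IsIrreducibleLaplacian M) (y : ι → ℝ) (p j : ι) :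
    0 ≤ M p j * (y j - y p) ^ 2 := by
  rcases eq_or_ne p j with rfl | h
  · simp
  · exact mul_nonneg (hM.offDiag_nonneg p j h) (sq_nonneg _)

theorem disagreement_nonneg (hM : IsIrreducibleLaplacian M) (y : ι → ℝ) (p : ι) :
    0 ≤ disagreement M y p :=
  Finset.sum_nonneg fun j _ => hM.mul_sq_nonneg y p j

theorem col_sum_eq_zero {w : ι → ℝ} (h : Matrix.vecMul w M = 0) (j : ι) :
    ∑ p, w p * M p j = 0 := by
  simpa [Matrix.vecMul, dotProduct] using congrFun h j

/-- Off-diagonal entries are nonnegative and diagonal ones nonpositive, so the triangle inequality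
makes every column sum weighted by `|w|` nonnegative. These sums add up to zero by the row sums,
hence each vanishes. -/
theorem abs_leftNull (hM : IsIrreducibleLaplacian M) {w : ι → ℝ} (h : Matrix.vecMul w M = 0)
    (j : ι) : ∑ p, |w p| * M p j = 0 := by
  classical
  have hnonneg : ∀ j ∈ Finset.univ, 0 ≤ ∑ p, |w p| * M p j := by
    intro j _
    have h1 := col_sum_eq_zero h j
    rw [← Finset.add_sum_erase _ _ (Finset.mem_univ j)] at h1 ⊢
    have h2 : |∑ p ∈ Finset.univ.erase j, w p * M p j|
        ≤ ∑ p ∈ Finset.univ.erase j, |w p| * M p j := by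
      refine (Finset.abs_sum_le_sum_abs _ _).trans (Finset.sum_le_sum fun p hp => ?_)
      rw [abs_mul, abs_of_nonneg (hM.offDiag_nonneg p j (Finset.ne_of_mem_erase hp))]
    have h3 : |w j * M j j| = -(|w j| * M j j) := by
      rw [abs_mul, abs_of_nonpos (hM.diag_nonpos j)]; ring
    have h4 : ∑ p ∈ Finset.univ.erase j, w p * M p j = -(w j * M j j) := by linarith
    rw [h4, abs_neg, h3] at h2
    linarith
  have hsum : ∑ j, ∑ p, |w p| * M p j = 0 := by
    rw [Finset.sum_comm]
    exact Finset.sum_eq_zero fun p _ => by rw [← Finset.mul_sum, hM.row_sum, mul_zero]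
  exact (Finset.sum_eq_zero_iff_of_nonneg hnonneg).1 hsum j (Finset.mem_univ j)

/-- The zero set of `w` is closed under out-links: at a zero `p` of `w`, column `p` is a vanishing
sum of nonnegative terms. If nonempty, it would be everything. -/
theorem pos_of_leftNull (hM : IsIrreducibleLaplacian M) {w : ι → ℝ} (hw : ∀ p, 0 ≤ w p)
    (h : ∀ j, ∑ p, w p * M p j = 0) {r : ι} (hr : w r ≠ 0) (p : ι) : 0 < w p := by
  classical
  refine (hw p).lt_of_ne' fun hp => hr ?_
  have hS := hM.eq_univ {p | w p = 0} ⟨p, hp⟩ (by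
    intro p q hp hpq hqp
    have h1 := h p
    have hp' : w p = 0 := hp
    rw [← Finset.add_sum_erase _ _ (Finset.mem_univ p), hp', zero_mul, zero_add] at h1
    have h2 := (Finset.sum_eq_zero_iff_of_nonneg fun s hs => mul_nonneg (hw s)
      (hM.offDiag_nonneg s p (Finset.ne_of_mem_erase hs))).1 h1 q
      (Finset.mem_erase.2 ⟨hpq.symm, Finset.mem_univ q⟩)
    exact (mul_eq_zero.1 h2).resolve_right hqp.ne')
  exact hS.ge (mem_univ r)

theorem exists_pos_leftNull [Nonempty ι] (hM : IsIrreducibleLaplacian M) :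
    ∃ w : ι → ℝ, (∀ p, 0 < w p) ∧ Matrix.vecMul w M = 0 := by
  classical
  have hdet : M.det = 0 := by
    refine Matrix.exists_mulVec_eq_zero_iff.1 ⟨fun _ => 1, ?_, ?_⟩
    · exact fun h => one_ne_zero (congrFun h (Classical.arbitrary ι))
    · ext p
      simpa [Matrix.mulVec, dotProduct] using hM.row_sum p
  obtain ⟨w, hw, hwM⟩ := Matrix.exists_vecMul_eq_zero_iff.2 hdet
  obtain ⟨r, hr⟩ := Function.ne_iff.1 hw
  refine ⟨fun p => |w p|, hM.pos_of_leftNull (fun p => abs_nonneg _) (hM.abs_leftNull hwM)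
    (r := r) (by simpa using hr), ?_⟩
  ext j
  simpa [Matrix.vecMul, dotProduct] using hM.abs_leftNull hwM j

/-- `|w| + w` is a nonnegative null vector, nonzero because some entry of `w` is positive. It is
therefore positive everywhere, and it would vanish wherever `w ≤ 0`. -/
theorem pos_of_leftNull_of_sum_pos (hM : IsIrreducibleLaplacian M) {w : ι → ℝ}
    (h : Matrix.vecMul w M = 0) (hsum : 0 < ∑ p, w p) (p : ι) : 0 < w p := by
  obtain ⟨r, -, hr⟩ : ∃ r ∈ Finset.univ, 0 < w r := by
    by_contra! hcon
    exact absurd (Finset.sum_nonpos hcon) (not_le.2 hsum)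
  have hpos := hM.pos_of_leftNull (w := fun p => |w p| + w p) (r := r)
    (fun p => by linarith [neg_abs_le (w p)])
    (fun j => by
      simp only [add_mul, Finset.sum_add_distrib, hM.abs_leftNull h j, col_sum_eq_zero h j,
        add_zero])
    (by have := abs_nonneg (w r); linarith) p
  by_contra! hp
  rw [abs_of_nonpos hp] at hpos
  linarith

/-- The decay of the weighted quadratic energy along the flow with a held state `y + e`. -/
theorem energy_le (hM : IsIrreducibleLaplacian M) {w : ι → ℝ} (hw : ∀ p, 0 < w p)
    (h : Matrix.vecMul w M = 0) (y e : ι → ℝ) :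
    ∑ p, w p * y p * ∑ j, M p j * (y j + e j)
      ≤ ∑ p, w p * (-(1 / 4) * disagreement M y p + -M p p * e p ^ 2) := by
  classical
  have hcol : ∀ a : ι → ℝ, ∑ p, ∑ j, w p * M p j * a j = 0 := fun a => by
    rw [Finset.sum_comm]
    exact Finset.sum_eq_zero fun j _ => by rw [← Finset.sum_mul, col_sum_eq_zero h, zero_mul]
  have hrow : ∀ a : ι → ℝ, ∑ p, ∑ j, w p * M p j * a p = 0 := fun a =>
    Finset.sum_eq_zero fun p _ => by
      rw [← Finset.sum_mul, ← Finset.mul_sum, hM.row_sum, mul_zero, zero_mul]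
  -- The two sides differ by `w p * M p j` times a function of `j` (killed by column sums) plus a
  -- function of `p` (killed by row sums).
  have h1 : ∑ p, w p * y p * ∑ j, M p j * (y j + e j)
      = ∑ p, ∑ j, w p * M p j * (-(1 / 2) * (y j - y p) ^ 2 + (y p - y j) * e j) := by
    have e1 := hcol fun j => (1 / 2) * y j ^ 2 + y j * e j
    have e2 := hrow fun j => (1 / 2) * y j ^ 2
    rw [← sub_eq_zero, ← Finset.sum_sub_distrib]
    rw [← e1, ← sub_zero (∑ p, ∑ j, _), ← neg_zero, ← e2, ← Finset.sum_neg_distrib,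
      ← Finset.sum_sub_distrib]
    refine Finset.sum_congr rfl fun p _ => ?_
    rw [Finset.mul_sum, ← Finset.sum_sub_distrib, ← Finset.sum_neg_distrib,
      ← Finset.sum_sub_distrib]
    refine Finset.sum_congr rfl fun j _ => by ring
  -- Column sums move the error weight `-M p p` onto the incoming entries as `e j ^ 2`. The
  -- comparison is then termwise, by Young's inequality off the diagonal and with equality on it.
  have h2 : ∑ p, w p * (-(1 / 4) * disagreement M y p + -M p p * e p ^ 2)
      = ∑ p, ∑ j, (w p * M p j * (-(1 / 4) * (y j - y p) ^ 2 + e j ^ 2)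
        + if p = j then -(w p * M p p * e p ^ 2) else 0) := by
    simp only [Finset.sum_add_distrib, mul_add, hcol, Finset.sum_ite_eq, Finset.mem_univ, if_true,
      add_zero, disagreement, Finset.mul_sum]
    congr 1
    · exact Finset.sum_congr rfl fun p _ => Finset.sum_congr rfl fun j _ => by ring
    · exact Finset.sum_congr rfl fun p _ => by ring
  rw [h1, h2]
  refine Finset.sum_le_sum fun p _ => Finset.sum_le_sum fun j _ => ?_
  split_ifs with hpj
  · subst hpj
    apply le_of_eq; ring
  · rw [add_zero]
    refine mul_le_mul_of_nonneg_left ?_ (mul_nonneg (hw p).le (hM.offDiag_nonneg p j hpj))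
    nlinarith [sq_nonneg ((y p - y j) / 2 - e j)]

theorem eq_of_disagreement_eq_zero (hM : IsIrreducibleLaplacian M) {y : ι → ℝ}
    (h : ∀ p, disagreement M y p = 0) (p r : ι) : y p = y r := by
  have hS := hM.eq_univ {p | y p = y r} ⟨r, rfl⟩ (by
    intro p q hp hpq hqp
    have h2 := (Finset.sum_eq_zero_iff_of_nonneg fun j _ => hM.mul_sq_nonneg y q j).1 (h q) p
      (Finset.mem_univ p)
    have h3 := pow_eq_zero_iff two_ne_zero |>.1 ((mul_eq_zero.1 h2).resolve_left hqp.ne')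
    have hp' : y p = y r := hp
    show y q = y r
    linarith)
  exact hS.ge (mem_univ p)

end IsIrreducibleLaplacian

end LaplacianMatrix

/-- A continuous function, homogeneous of degree two and positive on the nonzero vectors of a closed
cone, is coercive there. -/
theorem exists_coercive {ι : Type*} [Fintype ι] {Q : (ι → ℝ) → ℝ} (hQ : Continuous Q)
    (hQh : ∀ (a : ℝ) y, Q (a • y) = a ^ 2 * Q y) {S : Set (ι → ℝ)} (hS : IsClosed S)
    (hSh : ∀ (a : ℝ), ∀ y ∈ S, a • y ∈ S) (hpos : ∀ y ∈ S, y ≠ 0 → 0 < Q y) :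
    ∃ k : ℝ, 0 < k ∧ ∀ y ∈ S, k * ∑ p, y p ^ 2 ≤ Q y := by
  have hbound : ∃ k : ℝ, 0 < k ∧ ∀ y ∈ S, ‖y‖ = 1 → k ≤ Q y := by
    have hcomp : IsCompact (S ∩ Metric.sphere (0 : ι → ℝ) 1) :=
      (isCompact_sphere _ _).inter_left hS
    rcases (S ∩ Metric.sphere (0 : ι → ℝ) 1).eq_empty_or_nonempty with he | hne
    · refine ⟨1, one_pos, fun y hy hn => ?_⟩
      have : y ∈ S ∩ Metric.sphere (0 : ι → ℝ) 1 := ⟨hy, by simpa using hn⟩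
      simp [he] at this
    · obtain ⟨z, hz, hmin⟩ := hcomp.exists_isMinOn hne hQ.continuousOn
      have hz1 : ‖z‖ = 1 := by simpa using hz.2
      refine ⟨Q z, hpos z hz.1 fun h => by simp [h] at hz1, fun y hy hn => ?_⟩
      exact hmin ⟨hy, by simpa using hn⟩
  obtain ⟨k, hk, hkQ⟩ := hbound
  -- The cardinality converts the sup norm into the sum of squares; the `+ 1` covers an empty index
  -- type.
  refine ⟨k / (Fintype.card ι + 1), by positivity, fun y hy => ?_⟩
  have hnorm : k * ‖y‖ ^ 2 ≤ Q y := by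
    rcases eq_or_ne y 0 with rfl | hy0
    · have := hQh 0 0
      simp only [zero_smul, ne_eq, OfNat.ofNat_ne_zero, not_false_eq_true, zero_pow, zero_mul]
        at this
      simp [this]
    · have hny : ‖y‖ ≠ 0 := norm_ne_zero_iff.2 hy0
      have h1 := hkQ (‖y‖⁻¹ • y) (hSh _ y hy) (by rw [norm_smul, norm_inv, norm_norm]; field_simp)
      rw [hQh] at h1
      calc k * ‖y‖ ^ 2 ≤ (‖y‖⁻¹ ^ 2 * Q y) * ‖y‖ ^ 2 := by gcongr
        _ = Q y := by field_simp
  have hsum : ∑ p, y p ^ 2 ≤ (Fintype.card ι + 1) * ‖y‖ ^ 2 := by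
    calc ∑ p, y p ^ 2 ≤ ∑ _p : ι, ‖y‖ ^ 2 := Finset.sum_le_sum fun p _ => by
          rw [← sq_abs, ← Real.norm_eq_abs]
          gcongr
          exact norm_le_pi_norm y p
      _ = Fintype.card ι * ‖y‖ ^ 2 := by simp
      _ ≤ _ := by nlinarith [sq_nonneg ‖y‖]
  calc k / (Fintype.card ι + 1) * ∑ p, y p ^ 2
      ≤ k / (Fintype.card ι + 1) * ((Fintype.card ι + 1) * ‖y‖ ^ 2) := by gcongr
    _ = k * ‖y‖ ^ 2 := by field_simp
    _ ≤ Q y := hnorm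

/-! ### Energy decay for one component, isolated or driven by an input. -/

section Decay

variable {ι κ : Type*} [Fintype ι] [Fintype κ] {M : Matrix ι ι ℝ}

theorem continuous_disagreement (M : Matrix ι ι ℝ) (p : ι) :
    Continuous fun y => disagreement M y p := by
  unfold disagreement
  fun_prop

theorem disagreement_smul (M : Matrix ι ι ℝ) (a : ℝ) (y : ι → ℝ) (p : ι) :
    disagreement M (a • y) p = a ^ 2 * disagreement M y p := by
  simp only [disagreement, Finset.mul_sum, Pi.smul_apply, smul_eq_mul]
  exact Finset.sum_congr rfl fun j _ => by ring

namespace IsIrreducibleLaplacian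

/-- Energy decay for a strongly connected group without outside influence. -/
theorem exists_decay (hM : IsIrreducibleLaplacian M) {w : ι → ℝ} (hw : ∀ p, 0 < w p)
    (h : Matrix.vecMul w M = 0) {γ : ι → ℝ} (hγ : ∀ p, γ p < 1) :
    ∃ k : ℝ, 0 < k ∧ ∀ y e : ι → ℝ, ∑ p, w p * y p = 0 →
      (∀ p, -M p p * e p ^ 2 ≤ γ p / 4 * disagreement M y p) →
      ∑ p, w p * y p * ∑ j, M p j * (y j + e j) ≤ -(k * ∑ p, y p ^ 2) := by
  have hc : ∀ p, 0 < w p * ((1 - γ p) / 4) := fun p =>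
    mul_pos (hw p) (by linarith [hγ p])
  have hterm : ∀ y p, 0 ≤ w p * ((1 - γ p) / 4) * disagreement M y p := fun y p =>
    mul_nonneg (hc p).le (hM.disagreement_nonneg y p)
  -- Zero disagreement forces `y` to be constant, and the only constant vector of zero `w`-average
  -- is `0`.
  obtain ⟨k, hk, hkQ⟩ := exists_coercive
    (Q := fun y => ∑ p, w p * ((1 - γ p) / 4) * disagreement M y p)
    (S := {y : ι → ℝ | ∑ p, w p * y p = 0})
    (continuous_finsetSum _ fun p _ => continuous_const.mul (continuous_disagreement M p))
    (fun a y => by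
      simp only [disagreement_smul, Finset.mul_sum]
      exact Finset.sum_congr rfl fun p _ => by ring)
    (isClosed_eq (by fun_prop) continuous_const)
    (fun a y hy => by
      have hy' : ∑ p, w p * y p = 0 := hy
      have : ∑ p, w p * (a • y) p = a * ∑ p, w p * y p := by
        rw [Finset.mul_sum]
        exact Finset.sum_congr rfl fun p _ => by simp only [Pi.smul_apply, smul_eq_mul]; ring
      rw [mem_ofPred_eq, this, hy', mul_zero])
    (fun y hy hy0 => by
      refine (Finset.sum_nonneg fun p _ => hterm y p).lt_of_ne' fun hQ => hy0 ?_
      have hd : ∀ p, disagreement M y p = 0 := fun p =>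
        (mul_eq_zero.1 ((Finset.sum_eq_zero_iff_of_nonneg fun p _ => hterm y p).1 hQ p
          (Finset.mem_univ p))).resolve_left (hc p).ne'
      funext r
      have hy' : ∑ p, w p * y p = 0 := hy
      rw [Finset.sum_congr rfl fun p _ => by rw [hM.eq_of_disagreement_eq_zero hd p r],
        ← Finset.sum_mul] at hy'
      exact (mul_eq_zero.1 hy').resolve_left
        (Finset.sum_pos (fun p _ => hw p) ⟨r, Finset.mem_univ r⟩).ne')
  refine ⟨k, hk, fun y e hy he => (hM.energy_le hw h y e).trans ?_⟩
  refine le_trans ?_ (neg_le_neg (hkQ y hy))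
  rw [← Finset.sum_neg_distrib]
  refine Finset.sum_le_sum fun p _ => ?_
  have := mul_le_mul_of_nonneg_left (he p) (hw p).le
  linarith

/-- Energy decay, up to the size of the input, for a strongly connected group driven through a
nonzero nonnegative input matrix `B`. -/
theorem exists_decay_of_input (hM : IsIrreducibleLaplacian M) {w : ι → ℝ} (hw : ∀ p, 0 < w p)
    (h : Matrix.vecMul w M = 0) {B : Matrix ι κ ℝ} (hB : ∀ p j, 0 ≤ B p j) {r : ι}
    (hr : 0 < ∑ j, B r j) {γ d g : ι → ℝ} (hγ : ∀ p, γ p < 1)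
    (hd : ∀ p, 0 < d p ∧ d p < 1 / 2) (hg : ∀ p, 0 ≤ g p)
    (hgγ : ∀ p, g p * (4 * (-M p p + ∑ j, B p j) + (∑ j, B p j) / d p) ≤ γ p) :
    ∃ k C : ℝ, 0 < k ∧ 0 ≤ C ∧ ∀ (y e : ι → ℝ) (z f : κ → ℝ),
      (∀ p, e p ^ 2 ≤ g p * (disagreement M y p + ∑ j, B p j * (z j - y p) ^ 2)) →
      ∑ p, w p * y p * (∑ j, M p j * (y j + e j) - (∑ j, B p j) * (y p + e p)
          + ∑ j, B p j * (z j + f j))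
        ≤ -(k * ∑ p, y p ^ 2) + C * (∑ j, z j ^ 2 + ∑ j, f j ^ 2) := by
  set δ : ι → ℝ := fun p => ∑ j, B p j with hδ
  have hδ0 : ∀ p, 0 ≤ δ p := fun p => Finset.sum_nonneg fun j _ => hB p j
  -- Of the damping `δ p * y p ^ 2`, the fraction `d p` goes to the node's own held error and `γ p /
  -- 2` to the inter-component part of the trigger bound. Half of the remainder absorbs the input
  -- and half, `η p`, is kept. It is positive since `d p < 1 / 2` and `γ p < 1`.
  set η : ι → ℝ := fun p => (1 - d p - γ p / 2) / 2 with hη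
  have hη0 : ∀ p, 0 < η p := fun p => by have := hγ p; have := (hd p).2; simp only [hη]; linarith
  have hc : ∀ p, 0 < w p * ((1 - γ p) / 4) := fun p =>
    mul_pos (hw p) (by linarith [hγ p])
  have hterm1 : ∀ y p, 0 ≤ w p * ((1 - γ p) / 4) * disagreement M y p := fun y p =>
    mul_nonneg (hc p).le (hM.disagreement_nonneg y p)
  have hterm2 : ∀ (y : ι → ℝ) p, 0 ≤ w p * η p * δ p * y p ^ 2 := fun y p =>
    mul_nonneg (mul_nonneg (mul_pos (hw p) (hη0 p)).le (hδ0 p)) (sq_nonneg _)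
  obtain ⟨k, hk, hkQ⟩ := exists_coercive
    (Q := fun y => ∑ p, (w p * ((1 - γ p) / 4) * disagreement M y p + w p * η p * δ p * y p ^ 2))
    (S := univ)
    (continuous_finsetSum _ fun p _ =>
      (continuous_const.mul (continuous_disagreement M p)).add (by fun_prop))
    (fun a y => by
      simp only [disagreement_smul, Finset.mul_sum, Pi.smul_apply, smul_eq_mul]
      exact Finset.sum_congr rfl fun p _ => by ring)
    isClosed_univ (fun a y hy => mem_univ _)
    (fun y _ hy0 => by
      have hterm : ∀ p ∈ Finset.univ, 0 ≤ w p * ((1 - γ p) / 4) * disagreement M y p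
          + w p * η p * δ p * y p ^ 2 := fun p _ => add_nonneg (hterm1 y p) (hterm2 y p)
      refine (Finset.sum_nonneg hterm).lt_of_ne' fun hQ => hy0 ?_
      have h0 : ∀ p, w p * ((1 - γ p) / 4) * disagreement M y p + w p * η p * δ p * y p ^ 2 = 0 :=
        fun p => (Finset.sum_eq_zero_iff_of_nonneg hterm).1 hQ p (Finset.mem_univ p)
      have hd : ∀ p, disagreement M y p = 0 := fun p =>
        (mul_eq_zero.1 (by linarith [h0 p, hterm1 y p, hterm2 y p] :
          w p * ((1 - γ p) / 4) * disagreement M y p = 0)).resolve_left (hc p).ne'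
      -- The node `r` receives input, so the damping term anchors the common value at zero.
      have hyr : y r = 0 := by
        have h1 : w r * η r * δ r * y r ^ 2 = 0 := by linarith [h0 r, hterm1 y r, hterm2 y r]
        have h2 : w r * η r * δ r ≠ 0 := (mul_pos (mul_pos (hw r) (hη0 r)) hr).ne'
        exact pow_eq_zero_iff two_ne_zero |>.1 ((mul_eq_zero.1 h1).resolve_left h2)
      funext p
      rw [hM.eq_of_disagreement_eq_zero hd p r, hyr, Pi.zero_apply])
  set b : ι → κ → ℝ := fun p j => w p * (B p j * (1 + 1 / (2 * η p))) with hb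
  have hb0 : ∀ p j, 0 ≤ b p j := fun p j =>
    mul_nonneg (hw p).le (mul_nonneg (hB p j) (by have := hη0 p; positivity))
  refine ⟨k, ∑ p, ∑ j, b p j, hk, Finset.sum_nonneg fun p _ => Finset.sum_nonneg fun j _ => hb0 p j,
    fun y e z f he => ?_⟩
  have hpoint : ∀ p, w p * (-(1 / 4) * disagreement M y p + -M p p * e p ^ 2)
      + w p * y p * (-(δ p * (y p + e p)) + ∑ j, B p j * (z j + f j))
      ≤ -(w p * ((1 - γ p) / 4) * disagreement M y p + w p * η p * δ p * y p ^ 2)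
        + ∑ j, b p j * (z j ^ 2 + f j ^ 2) := by
    intro p
    obtain ⟨hdp, -⟩ := hd p
    have hηp := hη0 p
    have hcross : y p * ∑ j, B p j * (z j + f j)
        ≤ η p * δ p * y p ^ 2 + ∑ j, B p j * ((z j ^ 2 + f j ^ 2) / (2 * η p)) := by
      simp only [hδ, Finset.mul_sum, Finset.sum_mul]
      rw [← Finset.sum_add_distrib]
      refine Finset.sum_le_sum fun j _ => ?_
      have h1 : y p * (z j + f j) ≤ η p * y p ^ 2 + (z j ^ 2 + f j ^ 2) / (2 * η p) := by
        have h2 : η p * y p ^ 2 + (z j ^ 2 + f j ^ 2) / (2 * η p) - y p * (z j + f j)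
            = ((η p * y p - z j) ^ 2 + (η p * y p - f j) ^ 2) / (2 * η p) := by
          field_simp; ring
        have h3 : 0 ≤ ((η p * y p - z j) ^ 2 + (η p * y p - f j) ^ 2) / (2 * η p) := by positivity
        linarith
      have := mul_le_mul_of_nonneg_left h1 (hB p j)
      linarith
    have hself : -(y p * (δ p * e p)) ≤ δ p * (d p * y p ^ 2) + δ p / d p / 4 * e p ^ 2 := by
      have h2 : δ p * (d p * y p ^ 2) + δ p / d p / 4 * e p ^ 2 + y p * (δ p * e p)
          = δ p * (d p * y p + e p / 2) ^ 2 / d p := by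
        field_simp; ring
      have h3 : 0 ≤ δ p * (d p * y p + e p / 2) ^ 2 / d p :=
        div_nonneg (mul_nonneg (hδ0 p) (sq_nonneg _)) hdp.le
      linarith
    have hqK : ∑ j, B p j * (z j - y p) ^ 2 ≤ 2 * δ p * y p ^ 2 + 2 * ∑ j, B p j * z j ^ 2 := by
      simp only [hδ, Finset.mul_sum, Finset.sum_mul]
      rw [← Finset.sum_add_distrib]
      refine Finset.sum_le_sum fun j _ => ?_
      have := mul_nonneg (hB p j) (sq_nonneg (z j + y p))
      linarith
    have hqK0 : 0 ≤ ∑ j, B p j * (z j - y p) ^ 2 :=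
      Finset.sum_nonneg fun j _ => mul_nonneg (hB p j) (sq_nonneg _)
    have hq0 := hM.disagreement_nonneg y p
    set qK := ∑ j, B p j * (z j - y p) ^ 2
    set q := disagreement M y p
    have hcoef : 0 ≤ 4 * (-M p p + δ p) + δ p / d p := by
      have := hM.diag_nonpos p
      have := hδ0 p
      have : 0 ≤ δ p / d p := by positivity
      linarith
    have hγ0 : 0 ≤ γ p := (mul_nonneg (hg p) hcoef).trans (hgγ p)
    -- A quarter of the coefficient in `hgγ` exceeds the one here by `δ p`; this surplus is
    -- discarded.
    have herr : (-M p p + δ p / d p / 4) * e p ^ 2 ≤ γ p / 4 * (q + qK) := by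
      have h1 := mul_le_mul_of_nonneg_left (he p) hcoef
      have h2 := mul_le_mul_of_nonneg_right (hgγ p) (add_nonneg hq0 hqK0)
      have h3 := mul_nonneg (hδ0 p) (sq_nonneg (e p))
      linarith
    have hqK' := mul_le_mul_of_nonneg_left hqK (by linarith : 0 ≤ γ p / 4)
    have hz0 : 0 ≤ ∑ j, B p j * z j ^ 2 :=
      Finset.sum_nonneg fun j _ => mul_nonneg (hB p j) (sq_nonneg _)
    have hz1 : ∑ j, B p j * z j ^ 2 ≤ ∑ j, B p j * (z j ^ 2 + f j ^ 2) :=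
      Finset.sum_le_sum fun j _ => mul_le_mul_of_nonneg_left (by linarith [sq_nonneg (f j)]) (hB p j)
    have hz2 := mul_le_mul_of_nonneg_right (hγ p).le hz0
    have hsplit : ∑ j, b p j * (z j ^ 2 + f j ^ 2) = w p * (∑ j, B p j * (z j ^ 2 + f j ^ 2)
        + ∑ j, B p j * ((z j ^ 2 + f j ^ 2) / (2 * η p))) := by
      rw [← Finset.sum_add_distrib, Finset.mul_sum]
      exact Finset.sum_congr rfl fun j _ => by simp only [hb]; ring
    have hmain : (-(1 / 4) * q + -M p p * e p ^ 2)
        + y p * (-(δ p * (y p + e p)) + ∑ j, B p j * (z j + f j))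
        ≤ -((1 - γ p) / 4 * q + η p * δ p * y p ^ 2)
          + (∑ j, B p j * (z j ^ 2 + f j ^ 2)
            + ∑ j, B p j * ((z j ^ 2 + f j ^ 2) / (2 * η p))) := by
      have hηd : 2 * η p * (δ p * y p ^ 2) = (1 - d p - γ p / 2) * (δ p * y p ^ 2) := by
        simp only [hη]; ring
      linarith
    rw [hsplit]
    have := mul_le_mul_of_nonneg_left hmain (hw p).le
    linarith
  have hsum : ∑ p, ∑ j, b p j * (z j ^ 2 + f j ^ 2)
      ≤ (∑ p, ∑ j, b p j) * (∑ j, z j ^ 2 + ∑ j, f j ^ 2) := by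
    rw [Finset.sum_mul]
    refine Finset.sum_le_sum fun p _ => ?_
    rw [Finset.sum_mul, ← Finset.sum_add_distrib]
    exact Finset.sum_le_sum fun j _ => mul_le_mul_of_nonneg_left
      (Finset.single_le_sum (f := fun j => z j ^ 2 + f j ^ 2) (fun i _ => by positivity)
        (Finset.mem_univ j)) (hb0 p j)
  have hE := hM.energy_le hw h y e
  have hQ := hkQ y (mem_univ y)
  have htot := Finset.sum_le_sum fun p (_ : p ∈ Finset.univ) => hpoint p
  rw [Finset.sum_add_distrib, Finset.sum_add_distrib, Finset.sum_neg_distrib] at htot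
  have hLHS : ∑ p, w p * y p * (∑ j, M p j * (y j + e j) - δ p * (y p + e p)
          + ∑ j, B p j * (z j + f j)) = ∑ p, w p * y p * ∑ j, M p j * (y j + e j)
        + ∑ p, w p * y p * (-(δ p * (y p + e p)) + ∑ j, B p j * (z j + f j)) := by
    rw [← Finset.sum_add_distrib]
    exact Finset.sum_congr rfl fun p _ => by ring
  rw [hLHS]
  linarith

end IsIrreducibleLaplacian

end Decay

/-! ### Graph Laplacians in Perron-Frobenius form and their diagonal blocks. -/

section Network

namespace WeightedDigraph

variable {V : Type} [Fintype V] [DecidableEq V] (G : WeightedDigraph V)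

theorem laplacian_of_ne {i j : V} (h : i ≠ j) : G.laplacian i j = G.weight i j := by
  simp [laplacian, Matrix.diagonal_apply_ne _ h]

theorem laplacian_row_sum (i : V) : ∑ j, G.laplacian i j = 0 := by
  simp [laplacian, Matrix.diagonal_apply, Finset.sum_sub_distrib]

theorem laplacian_diag_nonpos (i : V) : G.laplacian i i ≤ 0 := by
  simpa [laplacian, G.weight_self] using Finset.sum_nonneg fun j _ => G.weight_nonneg i j

end WeightedDigraph

variable {K : ℕ} {n : Fin K → ℕ} {G : WeightedDigraph (Agent n)}

theorem blockTilde_of_ne (L : Matrix (Agent n) (Agent n) ℝ) (k : Fin K) {i j : Fin (n k)}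
    (h : i ≠ j) : blockTilde L k i j = L ⟨k, i⟩ ⟨k, j⟩ := by
  simp [blockTilde, block, h]

theorem blockTilde_row_sum (L : Matrix (Agent n) (Agent n) ℝ) (k : Fin K) (i : Fin (n k)) :
    ∑ j, blockTilde L k i j = 0 := by
  rw [← Finset.add_sum_erase _ _ (Finset.mem_univ i),
    Finset.sum_congr rfl fun j hj => blockTilde_of_ne L k (Finset.ne_of_mem_erase hj).symm]
  simp [blockTilde, block]

theorem laplacian_block_of_ne {k : Fin K} {i j : Fin (n k)} (h : i ≠ j) :
    G.laplacian ⟨k, i⟩ ⟨k, j⟩ = G.weight ⟨k, i⟩ ⟨k, j⟩ :=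
  G.laplacian_of_ne fun he => h (by simpa using he)

theorem laplacian_of_fst_ne {k l : Fin K} (h : k ≠ l) (i : Fin (n k)) (j : Fin (n l)) :
    G.laplacian ⟨k, i⟩ ⟨l, j⟩ = G.weight ⟨k, i⟩ ⟨l, j⟩ :=
  G.laplacian_of_ne fun he => h (congrArg Sigma.fst he)

theorem IsPerronFrobeniusForm.fst_le_of_link (hPF : IsPerronFrobeniusForm G) {a b : Agent n}
    (h : G.Link a b) : b.1 ≤ a.1 := by
  by_contra! hlt
  have h0 := congrFun (congrFun (hPF.upper b.1 a.1 hlt) b.2) a.2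
  have h1 : G.laplacian b a = 0 := h0
  rw [G.laplacian_of_ne fun he => hlt.ne (by rw [he])] at h1
  exact h.ne' h1

theorem IsPerronFrobeniusForm.isIrreducibleLaplacian (hPF : IsPerronFrobeniusForm G) (k : Fin K) :
    IsIrreducibleLaplacian (blockTilde G.laplacian k) where
  offDiag_nonneg p j h := by
    rw [blockTilde_of_ne _ _ h, laplacian_block_of_ne h]
    exact G.weight_nonneg _ _
  row_sum := blockTilde_row_sum _ k
  eq_univ S := by
    rintro ⟨s, hs⟩ hS
    refine eq_univ_of_forall fun q => ?_
    obtain ⟨v, hv⟩ := hPF.scc k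
    have hsv : (⟨k, s⟩ : Agent n) ∈ {w : Agent n | w.1 = k} := rfl
    have hqv : (⟨k, q⟩ : Agent n) ∈ {w : Agent n | w.1 = k} := rfl
    rw [hv] at hsv hqv
    have hsq : G.Reaches ⟨k, s⟩ ⟨k, q⟩ := hsv.2.trans hqv.1
    -- Links never raise the component index, so a path that leaves component `k` cannot return. A
    -- path ending in component `k` thus stays inside it, and `S` propagates along it.
    have key : ∀ b, G.Reaches ⟨k, s⟩ b → b.1 ≤ k ∧ ∀ q, b = ⟨k, q⟩ → q ∈ S := by
      intro b hb
      induction hb with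
      | refl => exact ⟨le_rfl, fun q hq => by obtain rfl : s = q := by simpa using hq
                                              exact hs⟩
      | tail _ hlink ih =>
        rename_i b c _
        have hle := hPF.fst_le_of_link hlink
        refine ⟨hle.trans ih.1, ?_⟩
        rintro q rfl
        obtain ⟨l, p⟩ := b
        obtain rfl : l = k := le_antisymm ih.1 hle
        have hp := ih.2 p rfl
        rcases eq_or_ne p q with rfl | hpq
        · exact hp
        · refine hS p q hp hpq ?_
          rw [blockTilde_of_ne _ _ hpq.symm, laplacian_block_of_ne hpq.symm]
          exact hlink
    exact (key _ hsq).2 q rfl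

theorem qIntra_eq_disagreement (L : Matrix (Agent n) (Agent n) ℝ) (y : Agent n → ℝ) (k : Fin K)
    (p : Fin (n k)) :
    qIntra L y ⟨k, p⟩ = disagreement (blockTilde L k) (fun j => y ⟨k, j⟩) p := by
  refine Finset.sum_congr rfl fun j _ => ?_
  rcases eq_or_ne p j with rfl | h
  · simp
  · rw [blockTilde_of_ne _ _ h, block]

end Network

/-! ### Two components: block identities and the combined energy. -/

section TwoBlocks

variable {n : Fin 2 → ℕ} {G : WeightedDigraph (Agent n)}

theorem sum_agent (f : Agent n → ℝ) : ∑ v, f v = ∑ p, f ⟨0, p⟩ + ∑ p, f ⟨1, p⟩ := by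
  rw [Fintype.sum_sigma, Fin.sum_univ_two]

theorem qInter_zero (L : Matrix (Agent n) (Agent n) ℝ) (y : Agent n → ℝ) (p : Fin (n 0)) :
    qInter L y ⟨0, p⟩ = ∑ j, block L 0 1 p j * (y ⟨1, j⟩ - y ⟨0, p⟩) ^ 2 := by
  have : Finset.univ.filter (fun l : Fin 2 => (0 : Fin 2) < l) = {1} := by decide
  simp [qInter, this]

theorem qInter_one (L : Matrix (Agent n) (Agent n) ℝ) (y : Agent n → ℝ) (p : Fin (n 1)) :
    qInter L y ⟨1, p⟩ = 0 := by
  have : Finset.univ.filter (fun l : Fin 2 => (1 : Fin 2) < l) = ∅ := by decide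
  simp [qInter, this]

theorem laplacian_one_zero (hPF : IsPerronFrobeniusForm G) (p : Fin (n 1)) (j : Fin (n 0)) :
    G.laplacian ⟨1, p⟩ ⟨0, j⟩ = 0 :=
  congrFun (congrFun (hPF.upper 1 0 (by decide)) p) j

theorem block_zero_one_nonneg (p : Fin (n 0)) (j : Fin (n 1)) :
    0 ≤ block G.laplacian 0 1 p j := by
  rw [block, laplacian_of_fst_ne (by decide)]
  exact G.weight_nonneg _ _

theorem laplacian_zero_diag (p : Fin (n 0)) :
    G.laplacian ⟨0, p⟩ ⟨0, p⟩
      = blockTilde G.laplacian 0 p p - ∑ j, block G.laplacian 0 1 p j := by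
  have h := G.laplacian_row_sum ⟨0, p⟩
  rw [sum_agent, ← Finset.add_sum_erase _ _ (Finset.mem_univ p)] at h
  simp only [blockTilde, block, if_true]
  linarith

theorem laplacian_one_block (hPF : IsPerronFrobeniusForm G) (p j : Fin (n 1)) :
    G.laplacian ⟨1, p⟩ ⟨1, j⟩ = blockTilde G.laplacian 1 p j := by
  rcases eq_or_ne p j with rfl | hpj
  · have h := G.laplacian_row_sum ⟨1, p⟩
    rw [sum_agent, ← Finset.add_sum_erase _ _ (Finset.mem_univ p),
      Finset.sum_eq_zero fun j _ => laplacian_one_zero hPF p j] at h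
    simp only [blockTilde, block, if_true]
    linarith
  · rw [blockTilde_of_ne _ _ hpj]

/-- Zero row sums of the whole Laplacian make `D^1_p` minus the total input weight, so `u` takes the
shape required by `exists_decay_of_input`. -/
theorem uCoeff_zero (d : Agent n → ℝ) (p : Fin (n 0)) :
    uCoeff G.laplacian d ⟨0, p⟩ = 4 * (-blockTilde G.laplacian 0 p p
      + ∑ j, block G.laplacian 0 1 p j) + (∑ j, block G.laplacian 0 1 p j) / d ⟨0, p⟩ := by
  have h1 : block G.laplacian 0 0 p p = G.laplacian ⟨0, p⟩ ⟨0, p⟩ := rfl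
  have h2 := G.laplacian_diag_nonpos ⟨0, p⟩
  simp only [uCoeff, blockD, Matrix.sub_apply]
  rw [h1, abs_of_nonpos h2, laplacian_zero_diag]
  ring

theorem uCoeff_one (hPF : IsPerronFrobeniusForm G) (d : Agent n → ℝ) (p : Fin (n 1)) :
    uCoeff G.laplacian d ⟨1, p⟩ = 4 * -blockTilde G.laplacian 1 p p := by
  have h1 : block G.laplacian 1 1 p p = G.laplacian ⟨1, p⟩ ⟨1, p⟩ := rfl
  have h2 := G.laplacian_diag_nonpos ⟨1, p⟩
  simp only [uCoeff, blockD, Matrix.sub_apply]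
  rw [h1, abs_of_nonpos h2, laplacian_one_block hPF]
  ring

theorem sum_laplacian_zero (a : Agent n → ℝ) (p : Fin (n 0)) :
    ∑ v, G.laplacian ⟨0, p⟩ v * a v
      = ∑ j, blockTilde G.laplacian 0 p j * a ⟨0, j⟩
        - (∑ j, block G.laplacian 0 1 p j) * a ⟨0, p⟩
        + ∑ j, block G.laplacian 0 1 p j * a ⟨1, j⟩ := by
  rw [sum_agent, ← Finset.add_sum_erase _ _ (Finset.mem_univ p),
    ← Finset.add_sum_erase Finset.univ (fun j => blockTilde G.laplacian 0 p j * a ⟨0, j⟩)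
      (Finset.mem_univ p), laplacian_zero_diag]
  have h : ∑ j ∈ Finset.univ.erase p, blockTilde G.laplacian 0 p j * a ⟨0, j⟩
      = ∑ j ∈ Finset.univ.erase p, G.laplacian ⟨0, p⟩ ⟨0, j⟩ * a ⟨0, j⟩ :=
    Finset.sum_congr rfl fun j hj => by
      rw [blockTilde_of_ne G.laplacian 0 (Finset.ne_of_mem_erase hj).symm]
  rw [h]
  simp only [block]
  ring

theorem sum_laplacian_one (hPF : IsPerronFrobeniusForm G) (a : Agent n → ℝ) (p : Fin (n 1)) :
    ∑ v, G.laplacian ⟨1, p⟩ v * a v = ∑ j, blockTilde G.laplacian 1 p j * a ⟨1, j⟩ := by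
  simp [sum_agent, laplacian_one_zero hPF, laplacian_one_block hPF]

theorem exists_pos_sum_block (hPF : IsPerronFrobeniusForm G) :
    ∃ r, 0 < ∑ j, block G.laplacian 0 1 r j := by
  obtain ⟨l, hl, hne⟩ := hPF.link 0 (by norm_num)
  obtain rfl : l = 1 := by omega
  by_contra! hcon
  refine hne ?_
  ext r j
  exact (Finset.sum_eq_zero_iff_of_nonneg fun j _ => block_zero_one_nonneg r j).1
    (le_antisymm (hcon r) (Finset.sum_nonneg fun j _ => block_zero_one_nonneg r j)) j
    (Finset.mem_univ j)

theorem uCoeff_nonneg (hPF : IsPerronFrobeniusForm G) {d : Agent n → ℝ} (hd : ∀ v, 0 < d v)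
    (v : Agent n) : 0 ≤ uCoeff G.laplacian d v := by
  obtain ⟨k, p⟩ := v
  obtain rfl | rfl : k = 0 ∨ k = 1 := by omega
  · rw [uCoeff_zero]
    have h1 := (hPF.isIrreducibleLaplacian 0).diag_nonpos p
    have h2 : 0 ≤ ∑ j, block G.laplacian 0 1 p j :=
      Finset.sum_nonneg fun j _ => block_zero_one_nonneg p j
    have h3 := div_nonneg h2 (hd ⟨0, p⟩).le
    linarith
  · rw [uCoeff_one hPF]
    have h1 := (hPF.isIrreducibleLaplacian 1).diag_nonpos p
    linarith

theorem qIntra_add_qInter_nonneg (hPF : IsPerronFrobeniusForm G) (y : Agent n → ℝ) (v : Agent n) :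
    0 ≤ qIntra G.laplacian y v + qInter G.laplacian y v := by
  obtain ⟨k, p⟩ := v
  have h1 := (hPF.isIrreducibleLaplacian k).disagreement_nonneg (fun j => y ⟨k, j⟩) p
  rw [← qIntra_eq_disagreement] at h1
  refine add_nonneg h1 ?_
  obtain rfl | rfl : k = 0 ∨ k = 1 := by omega
  · rw [qInter_zero]
    exact Finset.sum_nonneg fun j _ => mul_nonneg (block_zero_one_nonneg p j) (sq_nonneg _)
  · rw [qInter_one]

/-- There is a weighted quadratic energy which decays exponentially under the trigger bound. -/
theorem exists_energy (hPF : IsPerronFrobeniusForm G) {γ d : Agent n → ℝ}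
    (hγ : ∀ v, 0 < γ v ∧ γ v < 1) (hd : ∀ v, 0 < d v ∧ d v < 1 / 2) {ξ : Fin (n 1) → ℝ}
    (hξ : Matrix.vecMul ξ (blockTilde G.laplacian 1) = 0) (hξ_sum : ∑ p, ξ p = 1) :
    ∃ (w : Agent n → ℝ) (α : ℝ), (∀ v, 0 < w v) ∧ 0 < α ∧ ∀ y e : Agent n → ℝ,
      ∑ p, ξ p * y ⟨1, p⟩ = 0 →
      (∀ v, e v ^ 2 ≤ γ v / uCoeff G.laplacian d v
        * (qIntra G.laplacian y v + qInter G.laplacian y v)) →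
      ∑ v, w v * (2 * y v * ∑ j, G.laplacian v j * (y j + e j))
        ≤ -(2 * α) * ∑ v, w v * y v ^ 2 := by
  have hM0 := hPF.isIrreducibleLaplacian 0
  have hM1 := hPF.isIrreducibleLaplacian 1
  have hξ0 := hM1.pos_of_leftNull_of_sum_pos hξ (by rw [hξ_sum]; exact one_pos)
  obtain ⟨r, hr⟩ := exists_pos_sum_block hPF
  have : Nonempty (Fin (n 0)) := ⟨r⟩
  obtain ⟨ω, hω0, hω⟩ := hM0.exists_pos_leftNull
  have hu := uCoeff_nonneg hPF fun v => (hd v).1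
  -- Not an equality: when `u = 0` the quotient is `0` by convention.
  have hgu : ∀ v, γ v / uCoeff G.laplacian d v * uCoeff G.laplacian d v ≤ γ v := fun v => by
    rcases eq_or_ne (uCoeff G.laplacian d v) 0 with h | h
    · rw [h, mul_zero]; exact (hγ v).1.le
    · rw [div_mul_cancel₀ _ h]
  obtain ⟨k₁, hk₁, hdec₁⟩ := hM1.exists_decay hξ0 hξ (γ := fun p => γ ⟨1, p⟩) fun p => (hγ _).2
  obtain ⟨k₀, C, hk₀, hC, hdec₀⟩ := hM0.exists_decay_of_input hω0 hω
    (B := block G.laplacian 0 1) block_zero_one_nonneg hr (γ := fun p => γ ⟨0, p⟩)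
    (d := fun p => d ⟨0, p⟩) (g := fun p => γ ⟨0, p⟩ / uCoeff G.laplacian d ⟨0, p⟩)
    (fun p => (hγ _).2) (fun p => hd _) (fun p => div_nonneg (hγ _).1.le (hu _))
    (fun p => by rw [← uCoeff_zero]; exact hgu ⟨0, p⟩)
  -- The input to the first component contains the held errors of the second; through the trigger
  -- bound, `E` controls them by its states.
  obtain ⟨E, hE, hEdis⟩ : ∃ E : ℝ, 0 ≤ E ∧ ∀ z : Fin (n 1) → ℝ,
      ∑ p, γ ⟨1, p⟩ / uCoeff G.laplacian d ⟨1, p⟩ * disagreement (blockTilde G.laplacian 1) z p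
        ≤ E * ∑ p, z p ^ 2 := by
    refine ⟨∑ p, ∑ j, γ ⟨1, p⟩ / uCoeff G.laplacian d ⟨1, p⟩ *
      (|blockTilde G.laplacian 1 p j| * 4), ?_, fun z => ?_⟩
    · exact Finset.sum_nonneg fun p _ => Finset.sum_nonneg fun j _ =>
        mul_nonneg (div_nonneg (hγ _).1.le (hu _)) (by positivity)
    · rw [Finset.sum_mul]
      refine Finset.sum_le_sum fun p _ => ?_
      rw [disagreement, Finset.mul_sum, Finset.sum_mul]
      refine Finset.sum_le_sum fun j _ => ?_
      rw [mul_assoc]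
      refine mul_le_mul_of_nonneg_left ?_ (div_nonneg (hγ _).1.le (hu _))
      rw [mul_assoc]
      refine mul_le_mul (le_abs_self _) ?_ (sq_nonneg _) (abs_nonneg _)
      have hs : ∀ i, z i ^ 2 ≤ ∑ p, z p ^ 2 := fun i =>
        Finset.single_le_sum (f := fun i => z i ^ 2) (fun i _ => sq_nonneg _) (Finset.mem_univ i)
      linarith [hs p, hs j, sq_nonneg (z j + z p)]
  -- With this weight the decay of the second component covers the input cost `C * (1 + E)` and
  -- leaves coefficient `1`.
  set m : ℝ := (C * (1 + E) + 1) / k₁ with hm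
  have hm0 : 0 < m := by positivity
  set w : Agent n → ℝ := fun v => Fin.cases (motive := fun k => Fin (n k) → ℝ) ω
    (fun i => Fin.cases (motive := fun i => Fin (n i.succ) → ℝ) (fun p => m * ξ p)
      (fun i => i.elim0) i) v.1 v.2 with hw
  have hw_zero : ∀ p, w ⟨0, p⟩ = ω p := fun p => rfl
  have hw_one : ∀ p, w ⟨1, p⟩ = m * ξ p := fun p => rfl
  have hwpos : ∀ v, 0 < w v := by
    rintro ⟨k, p⟩
    fin_cases k
    · exact hω0 p
    · exact mul_pos hm0 (hξ0 p)
  have hk : 0 < min k₀ 1 := lt_min hk₀ one_pos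
  set W : ℝ := ∑ v, w v with hW
  have hW0 : 0 < W := Finset.sum_pos (fun v _ => hwpos v) ⟨⟨0, r⟩, Finset.mem_univ _⟩
  -- The decay obtained is at least `min k₀ 1` times the plain sum of squares, and the energy is at
  -- most `W` times that sum.
  refine ⟨w, min k₀ 1 / W, hwpos, by positivity, fun y e hy he => ?_⟩
  have he1 : ∀ p, e ⟨1, p⟩ ^ 2 ≤ γ ⟨1, p⟩ / uCoeff G.laplacian d ⟨1, p⟩
      * disagreement (blockTilde G.laplacian 1) (fun j => y ⟨1, j⟩) p := fun p => by
    have := he ⟨1, p⟩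
    rwa [qInter_one, add_zero, qIntra_eq_disagreement] at this
  have hdec1 := hdec₁ (fun p => y ⟨1, p⟩) (fun p => e ⟨1, p⟩) hy (fun p => by
    have hdis := hM1.disagreement_nonneg (fun j => y ⟨1, j⟩) p
    have h1 := mul_le_mul_of_nonneg_left (he1 p) (hu ⟨1, p⟩)
    have h2 := mul_le_mul_of_nonneg_right (hgu ⟨1, p⟩) hdis
    have h3 := uCoeff_one hPF d p
    rw [h3] at h1 h2
    linarith)
  have hdec0 := hdec₀ (fun p => y ⟨0, p⟩) (fun p => e ⟨0, p⟩) (fun p => y ⟨1, p⟩)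
    (fun p => e ⟨1, p⟩) (fun p => by
      have := he ⟨0, p⟩
      rwa [qInter_zero, qIntra_eq_disagreement] at this)
  have hf : ∑ p, e ⟨1, p⟩ ^ 2 ≤ E * ∑ p, y ⟨1, p⟩ ^ 2 :=
    (Finset.sum_le_sum fun p _ => he1 p).trans (hEdis fun p => y ⟨1, p⟩)
  have hsplit : ∑ v, w v * (2 * y v * ∑ j, G.laplacian v j * (y j + e j))
      = 2 * ∑ p, ω p * y ⟨0, p⟩ * (∑ j, blockTilde G.laplacian 0 p j * (y ⟨0, j⟩ + e ⟨0, j⟩)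
          - (∑ j, block G.laplacian 0 1 p j) * (y ⟨0, p⟩ + e ⟨0, p⟩)
          + ∑ j, block G.laplacian 0 1 p j * (y ⟨1, j⟩ + e ⟨1, j⟩))
        + 2 * (m * ∑ p, ξ p * y ⟨1, p⟩ *
          ∑ j, blockTilde G.laplacian 1 p j * (y ⟨1, j⟩ + e ⟨1, j⟩)) := by
    rw [sum_agent, Finset.mul_sum, Finset.mul_sum, Finset.mul_sum]
    congr 1
    · refine Finset.sum_congr rfl fun p _ => ?_
      rw [sum_laplacian_zero (fun v => y v + e v), hw_zero]; ring
    · refine Finset.sum_congr rfl fun p _ => ?_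
      rw [sum_laplacian_one hPF (fun v => y v + e v), hw_one]; ring
  have hmk : m * k₁ = C * (1 + E) + 1 := by rw [hm]; field_simp
  have h1 := mul_le_mul_of_nonneg_left hdec1 hm0.le
  have h2 := mul_le_mul_of_nonneg_left hf hC
  have hWy : ∑ v, w v * y v ^ 2 ≤ W * ∑ v, y v ^ 2 := by
    rw [hW, Finset.sum_mul]
    exact Finset.sum_le_sum fun v _ => mul_le_mul_of_nonneg_left
      (Finset.single_le_sum (f := fun v => y v ^ 2) (fun v _ => sq_nonneg _) (Finset.mem_univ v))
      (hwpos v).le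
  have hfin : min k₀ 1 / W * ∑ v, w v * y v ^ 2
      ≤ k₀ * ∑ p, y ⟨0, p⟩ ^ 2 + ∑ p, y ⟨1, p⟩ ^ 2 := by
    have hS0 : 0 ≤ ∑ p, y ⟨0, p⟩ ^ 2 := Finset.sum_nonneg fun p _ => sq_nonneg _
    have hS1 : 0 ≤ ∑ p, y ⟨1, p⟩ ^ 2 := Finset.sum_nonneg fun p _ => sq_nonneg _
    calc min k₀ 1 / W * ∑ v, w v * y v ^ 2
        ≤ min k₀ 1 / W * (W * ∑ v, y v ^ 2) := by gcongr
      _ = min k₀ 1 * ∑ p, y ⟨0, p⟩ ^ 2 + min k₀ 1 * ∑ p, y ⟨1, p⟩ ^ 2 := by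
          rw [sum_agent fun v => y v ^ 2]; field_simp
      _ ≤ k₀ * ∑ p, y ⟨0, p⟩ ^ 2 + 1 * ∑ p, y ⟨1, p⟩ ^ 2 := by
          gcongr
          · exact min_le_left _ _
          · exact min_le_right _ _
      _ = _ := by rw [one_mul]
  have h3 : m * -(k₁ * ∑ p, y ⟨1, p⟩ ^ 2) = -((C * (1 + E) + 1) * ∑ p, y ⟨1, p⟩ ^ 2) := by
    rw [← hmk]; ring
  rw [h3] at h1
  rw [hsplit]
  linarith

end TwoBlocks

/-! ### From the trigger rule to the error bound, and exponential convergence. -/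

section Trigger

variable {V : Type} {x : ℝ → V → ℝ} {θ : (V → ℝ) → V → ℝ} {τ : V → ℕ → EReal}

/-- Rules out the value `⊥`, so that `toReal` is faithful at every finite trigger time. -/
theorem ObeysTriggerRule.nonneg (h : ObeysTriggerRule x θ τ) (v : V) (l : ℕ) : 0 ≤ τ v l := by
  induction l with
  | zero => exact (h.start v).ge
  | succ l ih =>
    rcases eq_or_ne (τ v l) ⊤ with htop | htop
    · rw [h.stop_forever v l htop]; exact le_top
    · have hT := (EReal.coe_toReal htop (fun hb => by simp [hb] at ih)).symm
      rcases h.next v l _ hT with ⟨s, hs, hg⟩ | ⟨hs, -⟩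
      · rw [hs]
        rw [hT] at ih
        exact ih.trans (EReal.coe_le_coe_iff.2 hg.1.1)
      · rw [hs]; exact le_top

/-- As long as the trigger times do not accumulate, the held state stays within the threshold of
the current state. -/
theorem ObeysTriggerRule.abs_heldState_sub_le (h : ObeysTriggerRule x θ τ) {v : V}
    (hlim : Tendsto (τ v) atTop (𝓝 ⊤)) {t : ℝ} (ht : 0 ≤ t) :
    |heldState x τ t v - x t v| ≤ θ (x t) v := by
  -- Without accumulation of triggers the supremum in `lastIndex` is attained, instead of taking the
  -- default value of an unbounded set.
  have hbdd : BddAbove {k : ℕ | τ v k ≤ (t : EReal)} := by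
    obtain ⟨N, hN⟩ := eventually_atTop.1 (hlim.eventually (lt_mem_nhds (EReal.coe_lt_top t)))
    refine ⟨N, fun k hk => ?_⟩
    by_contra! hlt
    exact absurd (hN k hlt.le) (not_lt.2 hk)
  have hne : {k : ℕ | τ v k ≤ (t : EReal)}.Nonempty :=
    ⟨0, by simpa [h.start v] using ht⟩
  have hmem : τ v (lastIndex (τ v) t) ≤ (t : EReal) := Nat.sSup_mem hne hbdd
  have hnext : (t : EReal) < τ v (lastIndex (τ v) t + 1) := by
    by_contra! hle
    have : lastIndex (τ v) t + 1 ≤ lastIndex (τ v) t := le_csSup hbdd hle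
    omega
  have h0 := h.nonneg v (lastIndex (τ v) t)
  have hT := (EReal.coe_toReal (ne_top_of_le_ne_top (EReal.coe_ne_top t) hmem)
    (fun hb => by simp [hb] at h0)).symm
  rw [abs_sub_comm]
  unfold heldState
  set T := (τ v (lastIndex (τ v) t)).toReal
  rw [hT] at hmem
  have hTt : T ≤ t := EReal.coe_le_coe_iff.1 hmem
  rcases h.next v _ T hT with ⟨s, hs, hg⟩ | ⟨-, hall⟩
  · rw [hs] at hnext
    exact hg.1.2 t ⟨hTt, (EReal.coe_lt_coe_iff.1 hnext).le⟩
  · have hmem' : t ∈ admissibleTimes x θ v T := hall ▸ (mem_Ici.2 hTt)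
    exact hmem'.2 t ⟨hTt, le_rfl⟩

end Trigger

/-- A Grönwall inequality for right derivatives. -/
theorem le_mul_exp_of_hasDerivWithinAt {f f' : ℝ → ℝ} {a : ℝ} (hf : ContinuousOn f (Ici 0))
    (hf' : ∀ t, 0 ≤ t → HasDerivWithinAt f (f' t) (Ici t) t) (hle : ∀ t, 0 ≤ t → f' t ≤ -a * f t)
    {t : ℝ} (ht : 0 ≤ t) : f t ≤ f 0 * Real.exp (-a * t) := by
  have hexp : ∀ s, HasDerivAt (fun s => Real.exp (a * s)) (Real.exp (a * s) * a) s := fun s => by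
    simpa using ((hasDerivAt_id s).const_mul a).exp
  -- The product `f s * exp (a * s)` has nonpositive right derivative.
  have hmul : f t * Real.exp (a * t) ≤ f 0 := by
    refine image_le_of_deriv_right_le_deriv_boundary (f := fun s => f s * Real.exp (a * s))
      (f' := fun s => f' s * Real.exp (a * s) + f s * (Real.exp (a * s) * a)) (a := 0) (b := t)
      (B := fun _ => f 0) (B' := fun _ => 0)
      ((hf.mono Icc_subset_Ici_self).mul (by fun_prop))
      (fun s hs => (hf' s hs.1).mul (hexp s).hasDerivWithinAt) (by simp) continuousOn_const
      (fun s _ => hasDerivWithinAt_const _ _ _) (fun s hs => ?_) ⟨ht, le_rfl⟩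
    have := mul_le_mul_of_nonneg_right (hle s hs.1) (Real.exp_pos (a * s)).le
    linarith
  calc f t = f t * Real.exp (a * t) * Real.exp (-a * t) := by
        rw [mul_assoc, ← Real.exp_add]; simp
    _ ≤ _ := by gcongr

theorem ConvergesExponentially.tendsto {V : Type} {x : ℝ → V → ℝ} {c α : ℝ} (hα : 0 < α)
    (h : ConvergesExponentially x c α) (v : V) : Tendsto (fun t => x t v) atTop (𝓝 c) := by
  obtain ⟨C, hC⟩ := h
  refine tendsto_iff_norm_sub_tendsto_zero.2 ?_
  refine squeeze_zero' (Eventually.of_forall fun t => norm_nonneg _)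
    ((eventually_ge_atTop 0).mono fun t ht => hC t ht v) ?_
  have : Tendsto (fun t : ℝ => Real.exp (-α * t)) atTop (𝓝 0) :=
    Real.tendsto_exp_atBot.comp (tendsto_id.const_mul_atTop_of_neg (neg_lt_zero.2 hα))
  simpa using this.const_mul C

theorem mainTheorem5 (n : Fin 2 → ℕ) (G : WeightedDigraph (Agent n))
    (hTree : G.HasSpanningTree) (hPF : IsPerronFrobeniusForm G)
    (γ d : Agent n → ℝ)
    (hγ : ∀ v, 0 < γ v ∧ γ v < 1)
    (hd : ∀ v, 0 < d v ∧ d v < 1 / 2)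
    (ξ : Fin (n 1) → ℝ)
    (hξ : Matrix.vecMul ξ (blockTilde G.laplacian 1) = 0)
    (hξ_sum : ∑ p, ξ p = 1) :
    ∃ α : ℝ, 0 < α ∧
      ∀ (x : ℝ → Agent n → ℝ) (τ : Agent n → ℕ → EReal),
        IsSolution G.laplacian x τ →
        ObeysTriggerRule x (threshold G.laplacian γ d) τ →
        (∀ v, Tendsto (τ v) atTop (𝓝 ⊤)) →
          ConvergesExponentially x (∑ p, ξ p * x 0 ⟨1, p⟩) α ∧
          ∀ v, Tendsto (fun t => x t v) atTop (𝓝 (∑ p, ξ p * x 0 ⟨1, p⟩)) := by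
  obtain ⟨w, α, hw, hα, henergy⟩ := exists_energy hPF hγ hd hξ hξ_sum
  refine ⟨α, hα, fun x τ hsol hrule hlim => ?_⟩
  set c := ∑ p, ξ p * x 0 ⟨1, p⟩ with hc
  suffices hconv : ConvergesExponentially x c α from ⟨hconv, hconv.tendsto hα⟩
  -- The second component gets no input and `ξ` annihilates its block from the left, whatever the
  -- held states are.
  have hcons : ∀ t, 0 ≤ t → ∑ p, ξ p * x t ⟨1, p⟩ = c := by
    intro t ht
    refine constant_of_has_deriv_right_zero (f := fun t => ∑ p, ξ p * x t ⟨1, p⟩) (a := 0) (b := t)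
      ?_ (fun s hs => ?_) t ⟨ht, le_rfl⟩
    · exact continuousOn_finsetSum _ fun p _ =>
        continuousOn_const.mul ((hsol.continuousOn _).mono Icc_subset_Ici_self)
    · have h1 := HasDerivWithinAt.fun_sum (u := Finset.univ)
        fun p _ => (hsol.hasDeriv s hs.1 ⟨1, p⟩).const_mul (ξ p)
      convert h1 using 1
      simp only [sum_laplacian_one hPF, Finset.mul_sum]
      rw [Finset.sum_comm]
      refine (Finset.sum_eq_zero fun j _ => ?_).symm
      simp only [← mul_assoc]
      rw [← Finset.sum_mul, IsIrreducibleLaplacian.col_sum_eq_zero hξ, zero_mul]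
  have hderiv : ∀ t, 0 ≤ t → HasDerivWithinAt (fun t => ∑ v, w v * (x t v - c) ^ 2)
      (∑ v, w v * (2 * (x t v - c) * ∑ j, G.laplacian v j * heldState x τ t j)) (Ici t) t :=
    fun t ht => HasDerivWithinAt.fun_sum fun v _ => by
      simpa using (((hsol.hasDeriv t ht v).sub_const c).fun_pow 2).const_mul (w v)
  have hdecay : ∀ t, 0 ≤ t →
      ∑ v, w v * (2 * (x t v - c) * ∑ j, G.laplacian v j * heldState x τ t j)
        ≤ -(2 * α) * ∑ v, w v * (x t v - c) ^ 2 := by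
    intro t ht
    -- The Laplacian annihilates constants, so the dynamics can be centred at `c`; `qIntra` and
    -- `qInter` are translation invariant too.
    have hshift : ∀ v, ∑ j, G.laplacian v j * heldState x τ t j
        = ∑ j, G.laplacian v j * ((x t j - c) + (heldState x τ t j - x t j)) := fun v => by
      have : ∑ j, G.laplacian v j * c = 0 := by
        rw [← Finset.sum_mul, G.laplacian_row_sum, zero_mul]
      rw [← sub_zero (∑ j, _), ← this, ← Finset.sum_sub_distrib]
      exact Finset.sum_congr rfl fun j _ => by ring
    simp only [hshift]
    refine henergy (fun v => x t v - c) (fun v => heldState x τ t v - x t v) ?_ fun v => ?_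
    · simp only [mul_sub, Finset.sum_sub_distrib, ← Finset.sum_mul, hξ_sum, hcons t ht]
      ring
    · have h1 := hrule.abs_heldState_sub_le (hlim v) ht
      have hq : qIntra G.laplacian (fun v => x t v - c) v
          + qInter G.laplacian (fun v => x t v - c) v
          = qIntra G.laplacian (x t) v + qInter G.laplacian (x t) v := by
        simp only [qIntra, qInter, sub_sub_sub_cancel_right]
      rw [hq]
      unfold threshold at h1
      rw [← sq_abs]
      exact (Real.le_sqrt (abs_nonneg _) (mul_nonneg
        (div_nonneg (hγ v).1.le (uCoeff_nonneg hPF (fun v => (hd v).1) v))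
        (qIntra_add_qInter_nonneg hPF _ v))).1 h1
  have hcont : ContinuousOn (fun t => ∑ v, w v * (x t v - c) ^ 2) (Ici 0) :=
    continuousOn_finsetSum _ fun v _ =>
      continuousOn_const.mul (((hsol.continuousOn v).sub continuousOn_const).pow 2)
  -- Each agent has its own constant, from its single term of the energy; their sum serves all
  -- agents at once.
  refine ⟨∑ v, Real.sqrt ((∑ v, w v * (x 0 v - c) ^ 2) / w v), fun t ht v => ?_⟩
  have hg := le_mul_exp_of_hasDerivWithinAt hcont hderiv hdecay ht
  set W₀ := ∑ v, w v * (x 0 v - c) ^ 2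
  have hsingle : w v * (x t v - c) ^ 2 ≤ W₀ * Real.exp (-(2 * α) * t) :=
    (Finset.single_le_sum (f := fun v => w v * (x t v - c) ^ 2)
      (fun v _ => mul_nonneg (hw v).le (sq_nonneg _)) (Finset.mem_univ v)).trans hg
  have hexp : Real.exp (-(2 * α) * t) = Real.exp (-α * t) ^ 2 := by
    rw [← Real.exp_nat_mul]; congr 1; push_cast; ring
  have hsq : (x t v - c) ^ 2 ≤ W₀ / w v * Real.exp (-α * t) ^ 2 := by
    rw [← hexp, div_mul_eq_mul_div, le_div_iff₀ (hw v)]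
    linarith
  calc |x t v - c| ≤ Real.sqrt (W₀ / w v * Real.exp (-α * t) ^ 2) := Real.abs_le_sqrt hsq
    _ = Real.sqrt (W₀ / w v) * Real.exp (-α * t) := by
        rw [Real.sqrt_mul' _ (sq_nonneg _), Real.sqrt_sq (Real.exp_pos _).le]
    _ ≤ _ := by
        refine mul_le_mul_of_nonneg_right ?_ (Real.exp_pos _).le
        exact Finset.single_le_sum (f := fun v => Real.sqrt (W₀ / w v))
          (fun v _ => Real.sqrt_nonneg _) (Finset.mem_univ v)
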